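/- Let $N\ge 1$ and $p\ge 0$ be integers. Let $M$ be an $N\times N$ GUE matrix, that is, the unitarily invariant random complex Hermitian matrix $M=U\,\mathrm{diag}(x_1,\dots,x_N)\,U^*$, where $U$ is Haar distributed on $U(N)$ and independent of $(x_1,\dots,x_N)\in\mathbb{R}^N$, which has the joint density $$\frac{1}{\mathscr{Z}_N^{(H)}}\prod_{1\le j<k\le N}(x_j-x_k)^2\prod_{j=1}^N e^{-Nx_j^2/2},$$ with $\mathscr{Z}_N^{(H)}$ the normalisation constant. Write $\mathbb{E}_N^{(H)}$ for the expectation. For a partition $\lambda$ put $C_\lambda(n)=\prod_{j=1}^n\frac{(\lambda_j+n-j)!}{(n-j)!}$, and let $(N^{2p})$ be the partition with $2p$ parts equal to $N$. Put $$D_e(N)=\prod_{j=0}^{p-1}\frac{j!^2}{(m+j)!^2}\quad (N=2m),\qquad D_o(N)=(-1)^p\frac{m!}{(m+p)!}\prod_{j=0}^{p-1}\frac{j!^2}{(m+j)!^2}\quad (N=2m+1),$$ $$\gamma_p=\prod_{j=0}^{p-1}\frac{j!}{(p+j)!},\qquad \rho_{sc}(t)=\frac{1}{2\pi}\sqrt{4-t^2}.$$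 (1) For every $N\ge 1$ the random variable $\det M^{2p}$ is integrable and $$\mathbb{E}_N^{(H)}[\det M^{2p}]=\Big(-\frac{1}{2N}\Big)^{Np}C_{(N^{2p})}(2p)\times\begin{cases}D_e(N),& N\text{ even},\\ D_o(N),& N\text{ odd}.\end{cases}$$ (2) For fixed $p$, as $N\to\infty$, $$C_{(N^{2p})}(2p)D_e(N)=e^{-Np}(2N)^{Np+p^2}\gamma_p\Big[1+\frac{p}{6N}(4p^2+1)+O(N^{-2})\Big]\quad (N\text{ even}),$$ $$C_{(N^{2p})}(2p)D_o(N)=(-1)^pe^{-Np}(2N)^{Np+p^2}\gamma_p\Big[1+\frac{p}{3N}(2p^2-1)+O(N^{-2})\Big]\quad (N\text{ odd}).$$ (3) For fixed $p$, as $N\to\infty$ through all integers, $\mathbb{E}_N^{(H)}[\det M^{2p}]\sim e^{-Np}(2N)^{p^2}\gamma_p$, and the right-hand side equals the Brézin–Hikami expression $e^{-Np}e^{Npt^2/2}(2\pi N\rho_{sc}(t))^{p^2}\gamma_p$ at $t=0$. (4) More precisely, for fixed $p$, as $N\to\infty$, $$\mathbb{E}_N^{(H)}[\det M^{2p}]=e^{-Np}(2N)^{p^2}\gamma_p\times\begin{cases}1+\frac{p}{6N}(4p^2+1)+O(N^{-2}),&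 N\text{ even},\\ 1+\frac{p}{3N}(2p^2-1)+O(N^{-2}),& N\text{ odd}.\end{cases}$$ -/

import Mathlib

open MeasureTheory Filter Asymptotics Topology

noncomputable section

/-! ### The Gaussian unitary ensemble -/

/-- The unnormalised joint eigenvalue density
`∏_{j<k} (x_j - x_k)^2 ∏_j exp (-N x_j^2 / 2)` of the `N × N` GUE. -/
def gueWeight (N : ℕ) (x : Fin N → ℝ) : ℝ :=
  (∏ j : Fin N, ∏ k ∈ Finset.Ioi j, (x j - x k) ^ 2) *
    ∏ j : Fin N, Real.exp (-((N : ℝ) * x j ^ 2 / 2))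

/-- The normalisation constant `𝒵_N^{(H)}`. -/
def gueZ (N : ℕ) : ℝ := ∫ x : Fin N → ℝ, gueWeight N x

/-- The law on `ℝ^N` with density `p^{(H)}(x_1, …, x_N)`, the joint eigenvalue density of the
GUE. -/
def gueEigenvalueLaw (N : ℕ) : Measure (Fin N → ℝ) :=
  volume.withDensity fun x => ENNReal.ofReal (gueWeight N x / gueZ N)

instance unitaryGroupCompactSpace (N : ℕ) : CompactSpace (Matrix.unitaryGroup (Fin N) ℂ) := by
  refine (isCompact_iff_compactSpace
    (s := (Matrix.unitaryGroup (Fin N) ℂ : Set (Matrix (Fin N) (Fin N) ℂ)))).mp ?_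
  have hK : IsCompact (Set.univ.pi fun _ : Fin N => Set.univ.pi fun _ : Fin N =>
      Metric.closedBall (0 : ℂ) 1) :=
    isCompact_univ_pi fun _ => isCompact_univ_pi fun _ => isCompact_closedBall _ _
  refine IsCompact.of_isClosed_subset (X := Matrix (Fin N) (Fin N) ℂ) hK
    (isClosed_unitary (R := Matrix (Fin N) (Fin N) ℂ)) ?_
  intro U hU i _ j _
  simpa using entry_norm_bound_of_unitary hU i j

instance unitaryGroupMeasurableSpace (N : ℕ) :
    MeasurableSpace (Matrix.unitaryGroup (Fin N) ℂ) := borel _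

instance unitaryGroupBorelSpace (N : ℕ) : BorelSpace (Matrix.unitaryGroup (Fin N) ℂ) := ⟨rfl⟩

/-- Normalised Haar measure on the unitary group `U(N)`. -/
def unitaryHaar (N : ℕ) : Measure (Matrix.unitaryGroup (Fin N) ℂ) :=
  Measure.haarMeasure ⊤

/-- The sample space of the GUE: a Haar distributed unitary matrix `U`, and independently of it
real numbers `x_1, …, x_N` with joint density `p^{(H)}`. -/
def gueProb (N : ℕ) : Measure (Matrix.unitaryGroup (Fin N) ℂ × (Fin N → ℝ)) :=
  (unitaryHaar N).prod (gueEigenvalueLaw N)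

/-- The GUE matrix `M = U diag(x_1, …, x_N) U*`: its law is the unitarily invariant law on
`N × N` complex Hermitian matrices with joint eigenvalue density `p^{(H)}`. -/
def gueMatrix (N : ℕ) (ω : Matrix.unitaryGroup (Fin N) ℂ × (Fin N → ℝ)) :
    Matrix (Fin N) (Fin N) ℂ :=
  (ω.1 : Matrix (Fin N) (Fin N) ℂ) * Matrix.diagonal (fun i => ((ω.2 i : ℝ) : ℂ)) *
    star (ω.1 : Matrix (Fin N) (Fin N) ℂ)

/-- `𝔼_N^{(H)}[det M^k]`. -/
def gueDetMoment (N k : ℕ) : ℂ :=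
  ∫ ω, (gueMatrix N ω).det ^ k ∂(gueProb N)

/-! ### The constants -/

/-- `C_λ(n) = ∏_{j=1}^n (λ_j + n - j)! / (n - j)!` for a partition `λ = (λ_1, λ_2, …)`. -/
def Cpart (lam : ℕ → ℕ) (n : ℕ) : ℝ :=
  ∏ j ∈ Finset.Icc 1 n, ((lam j + n - j).factorial : ℝ) / ((n - j).factorial : ℝ)

/-- The rectangular partition `(N^k) = (N, …, N)` with `k` parts, indexed from `1`. -/
def rectPart (N k : ℕ) (j : ℕ) : ℕ := if 1 ≤ j ∧ j ≤ k then N else 0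

/-- `D_e(N) = ∏_{j=0}^{p-1} j!² / (m + j)!²`, where `N = 2m`. -/
def De (p N : ℕ) : ℝ :=
  ∏ j ∈ Finset.range p, (j.factorial : ℝ) ^ 2 / ((N / 2 + j).factorial : ℝ) ^ 2

/-- `D_o(N) = (-1)^p m! / (m + p)! ∏_{j=0}^{p-1} j!² / (m + j)!²`, where `N = 2m + 1`. -/
def Do (p N : ℕ) : ℝ :=
  (-1) ^ p * (((N / 2).factorial : ℝ) / ((N / 2 + p).factorial : ℝ)) *
    ∏ j ∈ Finset.range p, (j.factorial : ℝ) ^ 2 / ((N / 2 + j).factorial : ℝ) ^ 2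

/-- `γ_p = ∏_{j=0}^{p-1} j! / (p + j)!`. -/
def gammaConst (p : ℕ) : ℝ :=
  ∏ j ∈ Finset.range p, (j.factorial : ℝ) / ((p + j).factorial : ℝ)

/-- The Wigner semicircle density. -/
def rhoSC (x : ℝ) : ℝ := 1 / (2 * Real.pi) * Real.sqrt (4 - x ^ 2)

/-- The Brézin–Hikami expression
`e^{-Np} e^{Np t²/2} (2π N ρ_sc(t))^{p²} ∏_{j<p} j! / (p + j)!`. -/
def brezinHikami (p N : ℕ) (t : ℝ) : ℝ :=
  Real.exp (-((N : ℝ) * p)) * Real.exp ((N : ℝ) * p * t ^ 2 / 2) *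
    (2 * Real.pi * N * rhoSC t) ^ (p ^ 2) * gammaConst p

/-- `e^{-Np} (2N)^{p²} γ_p`. -/
def leadingTerm (p N : ℕ) : ℝ :=
  Real.exp (-((N : ℝ) * p)) * (2 * (N : ℝ)) ^ (p ^ 2) * gammaConst p

/-- `N → ∞` along even `N`. -/
def evenTop : Filter ℕ := atTop ⊓ 𝓟 {N | Even N}

/-- `N → ∞` along odd `N`. -/
def oddTop : Filter ℕ := atTop ⊓ 𝓟 {N | Odd N}

end

noncomputable section

/-! ### Andréief's identity -/

/-! Since det M = ∏ x_j, the unitary factor integrates out, and the moment is a quotient of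
integrals of the squared Vandermonde against the weights x^(2p) exp(-N x²/2) and exp(-N x²/2). By
Andréief each integral is N! times a Hankel determinant of Gaussian moments. Odd moments vanish, so
the determinant splits into an even-index and an odd-index block (`det_hankel_of_odd_eq_zero`). The
even moments obey a Gamma-type recurrence, which reduces each block to the product of its
first-column entries times a constant independent of p (`det_hankel_of_recurrence`). The constant
cancels in the quotient, leaving `momentProd N p / momentProd N 0`; passing from p to p + 1
multiplies this by a quotient of factorials, and induction on p gives the closed form.

The asymptotics use the same induction. The factor gained at each step is a quotient such as
N!²/(N/2)!², known from Stirling's formula with its 1/(12n) correction, times finitely many factors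
1 + c/N. Under `IsOneAddDiv` the 1/N coefficients add, and their sum over the steps is the stated
cubic in p. -/

theorem prod_Ioi_sub_sq_eq_det_vandermonde_sq {N : ℕ} (x : Fin N → ℝ) :
    ∏ j : Fin N, ∏ k ∈ Finset.Ioi j, (x j - x k) ^ 2 = (Matrix.vandermonde x).det ^ 2 := by
  rw [Matrix.det_vandermonde, ← Finset.prod_pow]
  refine Finset.prod_congr rfl fun j _ => ?_
  rw [← Finset.prod_pow]
  exact Finset.prod_congr rfl fun k _ => by ring

/-- Expanding both determinants by Leibniz leaves products of one-variable functions, to which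
Fubini applies. -/
theorem det_vandermonde_sq_mul_prod {N : ℕ} (w : ℝ → ℝ) (x : Fin N → ℝ) :
    (Matrix.vandermonde x).det ^ 2 * ∏ j, w (x j) =
      ∑ τ : Equiv.Perm (Fin N), ∑ σ : Equiv.Perm (Fin N),
        ((Equiv.Perm.sign τ : ℤ) : ℝ) * ((Equiv.Perm.sign σ : ℤ) : ℝ) *
          ∏ j, (x j ^ ((σ j : ℕ) + (τ j : ℕ)) * w (x j)) := by
  have h : (Matrix.vandermonde x).det =
      ∑ σ : Equiv.Perm (Fin N), ((Equiv.Perm.sign σ : ℤ) : ℝ) * ∏ j, x j ^ (σ j : ℕ) := by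
    rw [← Matrix.det_transpose, Matrix.det_apply']
    simp [Matrix.vandermonde_apply]
  rw [sq, h, Finset.sum_mul_sum, Finset.sum_mul]
  refine Finset.sum_congr rfl fun τ _ => ?_
  rw [Finset.sum_mul]
  refine Finset.sum_congr rfl fun σ _ => ?_
  simp only [pow_add, Finset.prod_mul_distrib]
  ring

theorem integrable_prod_pow_mul {N : ℕ} {w : ℝ → ℝ}
    (hw : ∀ k : ℕ, Integrable fun x : ℝ => x ^ k * w x) (e : Fin N → ℕ) :
    Integrable fun x : Fin N → ℝ => ∏ j, (x j ^ e j * w (x j)) :=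
  Integrable.fintype_prod (f := fun j y => y ^ e j * w y) fun j => hw (e j)

theorem integrable_det_vandermonde_sq_mul_prod {N : ℕ} {w : ℝ → ℝ}
    (hw : ∀ k : ℕ, Integrable fun x : ℝ => x ^ k * w x) :
    Integrable fun x : Fin N → ℝ => (Matrix.vandermonde x).det ^ 2 * ∏ j, w (x j) := by
  simp only [det_vandermonde_sq_mul_prod]
  exact integrable_finsetSum _ fun τ _ => integrable_finsetSum _ fun σ _ =>
    (integrable_prod_pow_mul hw _).const_mul _

theorem integral_det_vandermonde_sq_mul_prod {N : ℕ} {w : ℝ → ℝ}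
    (hw : ∀ k : ℕ, Integrable fun x : ℝ => x ^ k * w x) :
    ∫ x : Fin N → ℝ, (Matrix.vandermonde x).det ^ 2 * ∏ j, w (x j) =
      N.factorial *
        (Matrix.of fun i j : Fin N => ∫ x : ℝ, x ^ ((i : ℕ) + (j : ℕ)) * w x).det := by
  set M : Matrix (Fin N) (Fin N) ℝ :=
    Matrix.of fun i j : Fin N => ∫ x : ℝ, x ^ ((i : ℕ) + (j : ℕ)) * w x with hM
  simp only [det_vandermonde_sq_mul_prod]
  rw [integral_finsetSum _ fun τ _ => integrable_finsetSum _ fun σ _ =>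
    (integrable_prod_pow_mul hw _).const_mul _]
  have h : ∀ τ : Equiv.Perm (Fin N),
      ∫ x : Fin N → ℝ, ∑ σ : Equiv.Perm (Fin N),
        ((Equiv.Perm.sign τ : ℤ) : ℝ) * ((Equiv.Perm.sign σ : ℤ) : ℝ) *
          ∏ j, (x j ^ ((σ j : ℕ) + (τ j : ℕ)) * w (x j)) = M.det := by
    intro τ
    rw [integral_finsetSum _ fun σ _ => (integrable_prod_pow_mul hw _).const_mul _]
    -- For fixed τ the sum over σ is the determinant of M with columns permuted by τ. Its sign
    -- cancels the sign of τ, so each of the N! permutations τ contributes det M.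
    have h1 := Matrix.det_permute' τ M
    rw [Matrix.det_apply'] at h1
    have h2 : ((Equiv.Perm.sign τ : ℤ) : ℝ) * ((Equiv.Perm.sign τ : ℤ) : ℝ) = 1 := by
      rw [← Int.cast_mul, Int.units_coe_mul_self, Int.cast_one]
    calc _ = ((Equiv.Perm.sign τ : ℤ) : ℝ) * ∑ σ : Equiv.Perm (Fin N),
          ((Equiv.Perm.sign σ : ℤ) : ℝ) * ∏ j, M.submatrix id τ (σ j) j := by
          rw [Finset.mul_sum]
          refine Finset.sum_congr rfl fun σ _ => ?_
          rw [integral_const_mul, integral_fintype_prod_volume_eq_prod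
            (f := fun j y => y ^ ((σ j : ℕ) + (τ j : ℕ)) * w y), mul_assoc]
          rfl
      _ = M.det := by rw [h1, ← mul_assoc, h2, one_mul]
  simp only [h, Finset.sum_const, Finset.card_univ, Fintype.card_perm, Fintype.card_fin,
    nsmul_eq_mul]

/-! ### Hankel determinants -/

/-- The even elements of `Fin N`. -/
def finEvenEquiv (N : ℕ) : Fin ((N + 1) / 2) ≃ {i : Fin N // Even (i : ℕ)} where
  toFun i := ⟨⟨2 * i, by omega⟩, even_two_mul _⟩
  invFun i := ⟨(i.1 : ℕ) / 2, by omega⟩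
  left_inv i := by ext; simp
  right_inv i := by
    ext
    have := Nat.two_mul_div_two_of_even i.2
    simpa using this

/-- The odd elements of `Fin N`. -/
def finOddEquiv (N : ℕ) : Fin (N / 2) ≃ {i : Fin N // ¬ Even (i : ℕ)} where
  toFun i := ⟨⟨2 * i + 1, by omega⟩, by simp⟩
  invFun i := ⟨(i.1 : ℕ) / 2, by
    have := Nat.two_mul_div_two_add_one_of_odd (Nat.not_even_iff_odd.mp i.2)
    omega⟩
  left_inv i := by ext; simp; omega
  right_inv i := by
    ext
    have := Nat.two_mul_div_two_add_one_of_odd (Nat.not_even_iff_odd.mp i.2)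
    simpa using this

/-- Entries whose indices have opposite parity vanish, so sorting the indices by parity makes the
matrix block diagonal. -/
theorem det_hankel_of_odd_eq_zero (N : ℕ) {m : ℕ → ℝ} (hm : ∀ k, Odd k → m k = 0) :
    (Matrix.of fun i j : Fin N => m ((i : ℕ) + (j : ℕ))).det =
      (Matrix.of fun i j : Fin ((N + 1) / 2) => m (2 * ((i : ℕ) + (j : ℕ)))).det *
        (Matrix.of fun i j : Fin (N / 2) => m (2 * ((i : ℕ) + (j : ℕ) + 1))).det := by
  rw [Matrix.twoBlockTriangular_det _ (fun i : Fin N => Even (i : ℕ))]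
  · rw [← Matrix.det_submatrix_equiv_self (finEvenEquiv N),
      ← Matrix.det_submatrix_equiv_self (finOddEquiv N)]
    congr 2
    · ext i j
      simp [finEvenEquiv, Matrix.toSquareBlockProp, mul_add]
    · ext i j
      simp only [finOddEquiv, Matrix.toSquareBlockProp, Matrix.submatrix_apply, Equiv.coe_fn_mk,
        Matrix.of_apply, Matrix.toBlock_apply]
      congr 1
      ring
  · intro i hi j hj
    exact hm _ ((Nat.not_even_iff_odd.mp hi).add_even hj)

/-- The Hankel determinant of a sequence satisfying a first order recurrence of Gamma type. -/
theorem det_hankel_of_recurrence (n : ℕ) {f : ℕ → ℝ} {a b : ℝ}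
    (hf : ∀ k, f (k + 1) = (a + k) * b * f k) :
    (Matrix.of fun i j : Fin n => f ((i : ℕ) + (j : ℕ))).det =
      (∏ i : Fin n, f i) * ((∏ j : Fin n, b ^ (j : ℕ)) *
        (Matrix.vandermonde fun i : Fin n => ((i : ℕ) : ℝ)).det) := by
  -- Iterating the recurrence j times produces a rising factorial, a monic polynomial of degree j in
  -- i. Column operations then reduce the matrix to a Vandermonde in the points a + i, whose
  -- differences do not involve a.
  have hshift : ∀ i j : ℕ, f (i + j) = f i * (b ^ j * (ascPochhammer ℝ j).eval (a + i)) := by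
    intro i j
    induction j with
    | zero => simp
    | succ j ih =>
      rw [← add_assoc, hf, ih, ascPochhammer_succ_eval, pow_succ]
      push_cast
      ring
  have hdet : (Matrix.of fun i j : Fin n => (ascPochhammer ℝ (j : ℕ)).eval (a + (i : ℕ))).det =
      (Matrix.vandermonde fun i : Fin n => ((i : ℕ) : ℝ)).det := by
    rw [← Matrix.det_eval_matrixOfPolynomials_eq_det_vandermonde (fun i : Fin n => a + (i : ℕ))
      (fun j => ascPochhammer ℝ (j : ℕ)) (fun j => ascPochhammer_natDegree ℝ _)
      (fun j => monic_ascPochhammer ℝ _)]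
    simp only [Matrix.det_vandermonde, add_sub_add_left_eq_sub]
  rw [← hdet, ← Matrix.det_mul_row, ← Matrix.det_mul_column]
  congr 1
  ext i j
  exact hshift i j

theorem det_vandermonde_nat_ne_zero (n : ℕ) :
    (Matrix.vandermonde fun i : Fin n => ((i : ℕ) : ℝ)).det ≠ 0 := by
  rw [Matrix.det_vandermonde_ne_zero_iff]
  intro i j h
  exact Fin.ext (Nat.cast_injective (R := ℝ) h)

/-! ### Moments of the Gaussian weight -/

/-- The moments of the weight `exp (-N x² / 2)`. -/
def gaussMoment (N k : ℕ) : ℝ := ∫ x : ℝ, x ^ k * Real.exp (-((N : ℝ) * x ^ 2 / 2))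

theorem integrable_pow_mul_exp {N : ℕ} (hN : 1 ≤ N) (k : ℕ) :
    Integrable fun x : ℝ => x ^ k * Real.exp (-((N : ℝ) * x ^ 2 / 2)) := by
  have hb : (0 : ℝ) < (N : ℝ) / 2 := by positivity
  have h := integrable_rpow_mul_exp_neg_mul_sq hb (s := k) (by linarith [k.cast_nonneg (α := ℝ)])
  simp only [Real.rpow_natCast] at h
  refine h.congr (Eventually.of_forall fun x => ?_)
  simp only
  congr 2
  ring

theorem gaussMoment_odd (N : ℕ) {k : ℕ} (hk : Odd k) : gaussMoment N k = 0 := by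
  have h := integral_neg_eq_self
    (fun x : ℝ => x ^ k * Real.exp (-((N : ℝ) * x ^ 2 / 2))) (volume : Measure ℝ)
  simp only [hk.neg_pow, neg_sq, neg_mul] at h
  rw [integral_neg] at h
  unfold gaussMoment
  linarith

theorem gaussMoment_two_mul {N : ℕ} (hN : 1 ≤ N) (k : ℕ) :
    gaussMoment N (2 * k) =
      ((N : ℝ) / 2) ^ (-((k : ℝ) + 1 / 2)) * Real.Gamma ((k : ℝ) + 1 / 2) := by
  have hb : (0 : ℝ) < (N : ℝ) / 2 := by positivity
  have h := integral_rpow_mul_exp_neg_mul_rpow (p := 2) (q := ((2 * k : ℕ) : ℝ)) two_pos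
    (by linarith [(2 * k).cast_nonneg (α := ℝ)]) hb
  have h2 := integral_comp_abs (f := fun x : ℝ => x ^ (2 * k) * Real.exp (-((N : ℝ) / 2) * x ^ 2))
  simp only [Real.rpow_natCast, Real.rpow_two] at h
  simp only [sq_abs, (even_two_mul k).pow_abs] at h2
  have h3 : gaussMoment N (2 * k) =
      ∫ x : ℝ, x ^ (2 * k) * Real.exp (-((N : ℝ) / 2) * x ^ 2) := by
    unfold gaussMoment
    congr 1
    ext x
    congr 2
    ring
  rw [h3, h2, h]
  have e1 : -(((2 * k : ℕ) : ℝ) + 1) / 2 = -((k : ℝ) + 1 / 2) := by push_cast; ring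
  have e2 : (((2 * k : ℕ) : ℝ) + 1) / 2 = (k : ℝ) + 1 / 2 := by push_cast; ring
  rw [e1, e2]
  ring

theorem gaussMoment_two_mul_pos {N : ℕ} (hN : 1 ≤ N) (k : ℕ) : 0 < gaussMoment N (2 * k) := by
  rw [gaussMoment_two_mul hN]
  have hb : (0 : ℝ) < (N : ℝ) / 2 := by positivity
  exact mul_pos (Real.rpow_pos_of_pos hb _) (Real.Gamma_pos_of_pos (by positivity))

theorem gaussMoment_two_mul_succ {N : ℕ} (hN : 1 ≤ N) (k : ℕ) :
    gaussMoment N (2 * (k + 1)) = (1 / 2 + k) * (2 / N) * gaussMoment N (2 * k) := by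
  have hb : (0 : ℝ) < (N : ℝ) / 2 := by positivity
  have hN0 : (N : ℝ) ≠ 0 := by positivity
  rw [gaussMoment_two_mul hN, gaussMoment_two_mul hN]
  have e1 : ((k + 1 : ℕ) : ℝ) + 1 / 2 = ((k : ℝ) + 1 / 2) + 1 := by push_cast; ring
  rw [e1, Real.Gamma_add_one (by positivity), neg_add, Real.rpow_add hb, Real.rpow_neg_one,
    inv_div]
  ring

/-- The Hankel determinant of the weight `x^{2p} exp (-N x² / 2)`. -/
theorem det_hankel_gaussMoment {N : ℕ} (hN : 1 ≤ N) :
    ∃ c : ℝ, c ≠ 0 ∧ ∀ p : ℕ,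
      (Matrix.of fun i j : Fin N => gaussMoment N ((i : ℕ) + (j : ℕ) + 2 * p)).det =
        c * ((∏ i : Fin ((N + 1) / 2), gaussMoment N (2 * (i + p))) *
          ∏ i : Fin (N / 2), gaussMoment N (2 * (i + 1 + p))) := by
  have hN0 : (N : ℝ) ≠ 0 := by positivity
  have hb : ∀ n : ℕ, ∏ j : Fin n, ((2 : ℝ) / N) ^ (j : ℕ) ≠ 0 := fun n =>
    Finset.prod_ne_zero_iff.mpr fun j _ => pow_ne_zero _ (by positivity)
  -- The constant collects the powers of 2/N and the two Vandermondes. The shift by p only changes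
  -- the parameter a of the recurrence, which drops out, so one constant serves every p.
  refine ⟨_, mul_ne_zero
    (mul_ne_zero (hb ((N + 1) / 2)) (det_vandermonde_nat_ne_zero ((N + 1) / 2)))
    (mul_ne_zero (hb (N / 2)) (det_vandermonde_nat_ne_zero (N / 2))), fun p => ?_⟩
  rw [det_hankel_of_odd_eq_zero N (m := fun k => gaussMoment N (k + 2 * p))
    (fun k hk => gaussMoment_odd N (hk.add_even (even_two_mul p)))]
  have h1 := det_hankel_of_recurrence ((N + 1) / 2) (f := fun k => gaussMoment N (2 * (k + p)))
    (a := 1 / 2 + p) (b := 2 / N) fun k => by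
      have := gaussMoment_two_mul_succ hN (k + p)
      rw [show k + p + 1 = k + 1 + p by ring] at this
      rw [this]
      push_cast
      ring
  have h2 := det_hankel_of_recurrence (N / 2) (f := fun k => gaussMoment N (2 * (k + 1 + p)))
    (a := 3 / 2 + p) (b := 2 / N) fun k => by
      have := gaussMoment_two_mul_succ hN (k + 1 + p)
      rw [show k + 1 + p + 1 = k + 1 + 1 + p by ring] at this
      rw [this]
      push_cast
      ring
  simp only [← mul_add]
  rw [h1, h2]
  ring

/-! ### Reduction of the moments to Hankel determinants -/

theorem gueWeight_mul_prod_pow (N p : ℕ) (x : Fin N → ℝ) :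
    gueWeight N x * (∏ j, x j) ^ (2 * p) = (Matrix.vandermonde x).det ^ 2 *
      ∏ j, (x j ^ (2 * p) * Real.exp (-((N : ℝ) * x j ^ 2 / 2))) := by
  rw [gueWeight, prod_Ioi_sub_sq_eq_det_vandermonde_sq, Finset.prod_mul_distrib,
    Finset.prod_pow]
  ring

theorem integrable_pow_mul_pow_mul_exp {N : ℕ} (hN : 1 ≤ N) (p k : ℕ) :
    Integrable fun x : ℝ => x ^ k * (x ^ (2 * p) * Real.exp (-((N : ℝ) * x ^ 2 / 2))) := by
  simpa only [pow_add, mul_assoc] using integrable_pow_mul_exp hN (k + 2 * p)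

theorem integrable_gueWeight_mul_prod_pow {N : ℕ} (hN : 1 ≤ N) (p : ℕ) :
    Integrable fun x : Fin N → ℝ => gueWeight N x * (∏ j, x j) ^ (2 * p) := by
  simp only [gueWeight_mul_prod_pow]
  exact integrable_det_vandermonde_sq_mul_prod
    (w := fun x => x ^ (2 * p) * Real.exp (-((N : ℝ) * x ^ 2 / 2)))
    (integrable_pow_mul_pow_mul_exp hN p)

theorem integral_gueWeight_mul_prod_pow {N : ℕ} (hN : 1 ≤ N) (p : ℕ) :
    ∫ x : Fin N → ℝ, gueWeight N x * (∏ j, x j) ^ (2 * p) = N.factorial *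
      (Matrix.of fun i j : Fin N => gaussMoment N ((i : ℕ) + (j : ℕ) + 2 * p)).det := by
  simp only [gueWeight_mul_prod_pow]
  rw [integral_det_vandermonde_sq_mul_prod
    (w := fun x => x ^ (2 * p) * Real.exp (-((N : ℝ) * x ^ 2 / 2)))
    (integrable_pow_mul_pow_mul_exp hN p)]
  simp only [gaussMoment, pow_add, mul_assoc]

theorem gueWeight_nonneg (N : ℕ) (x : Fin N → ℝ) : 0 ≤ gueWeight N x := by
  unfold gueWeight
  positivity

theorem gueZ_nonneg (N : ℕ) : 0 ≤ gueZ N := integral_nonneg (gueWeight_nonneg N)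

theorem measurable_gueDensity (N : ℕ) :
    Measurable fun x : Fin N → ℝ => ENNReal.ofReal (gueWeight N x / gueZ N) := by
  unfold gueWeight
  fun_prop

theorem gueMatrix_det (N : ℕ) (ω : Matrix.unitaryGroup (Fin N) ℂ × (Fin N → ℝ)) :
    (gueMatrix N ω).det = ((∏ j, ω.2 j : ℝ) : ℂ) := by
  have h : (ω.1 : Matrix (Fin N) (Fin N) ℂ).det * (star (ω.1 : Matrix (Fin N) (Fin N) ℂ)).det
      = 1 := by
    rw [← Matrix.det_mul, Matrix.mem_unitaryGroup_iff.mp ω.1.2, Matrix.det_one]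
  rw [gueMatrix, Matrix.det_mul, Matrix.det_mul, Matrix.det_diagonal, mul_right_comm, h, one_mul,
    Complex.ofReal_prod]

instance unitaryHaar_isProbabilityMeasure (N : ℕ) : IsProbabilityMeasure (unitaryHaar N) :=
  ⟨Measure.haarMeasure_self (K₀ := (⊤ : TopologicalSpace.PositiveCompacts _))⟩

instance gueEigenvalueLaw_sFinite (N : ℕ) : SFinite (gueEigenvalueLaw N) := by
  unfold gueEigenvalueLaw
  infer_instance

theorem toReal_gueDensity_smul (N p : ℕ) (x : Fin N → ℝ) :
    (ENNReal.ofReal (gueWeight N x / gueZ N)).toReal • (∏ j, x j) ^ (2 * p) =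
      (gueZ N)⁻¹ * (gueWeight N x * (∏ j, x j) ^ (2 * p)) := by
  rw [ENNReal.toReal_ofReal (div_nonneg (gueWeight_nonneg N x) (gueZ_nonneg N)), smul_eq_mul]
  ring

theorem integrable_prod_pow_gueEigenvalueLaw {N : ℕ} (hN : 1 ≤ N) (p : ℕ) :
    Integrable (fun x : Fin N → ℝ => (∏ j, x j) ^ (2 * p)) (gueEigenvalueLaw N) := by
  rw [gueEigenvalueLaw, integrable_withDensity_iff_integrable_smul' (measurable_gueDensity N)
    (ae_of_all _ fun _ => ENNReal.ofReal_lt_top)]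
  simp only [toReal_gueDensity_smul]
  exact (integrable_gueWeight_mul_prod_pow hN p).const_mul _

theorem integrable_gueMatrix_det_pow {N : ℕ} (hN : 1 ≤ N) (p : ℕ) :
    Integrable (fun ω => (gueMatrix N ω).det ^ (2 * p)) (gueProb N) := by
  simp only [gueMatrix_det, ← Complex.ofReal_pow]
  exact ((integrable_prod_pow_gueEigenvalueLaw hN p).comp_snd (unitaryHaar N)).ofReal

/-- The product over the diagonal of the factorised Hankel determinant. -/
def momentProd (N p : ℕ) : ℝ :=
  (∏ i ∈ Finset.range ((N + 1) / 2), gaussMoment N (2 * (i + p))) *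
    ∏ i ∈ Finset.range (N / 2), gaussMoment N (2 * (i + 1 + p))

/-- The case p = 0 of the same integral is the normalisation, so N! and the Hankel constant cancel.
-/
theorem gueDetMoment_eq_momentProd {N : ℕ} (hN : 1 ≤ N) (p : ℕ) :
    gueDetMoment N (2 * p) = ((momentProd N p / momentProd N 0 : ℝ) : ℂ) := by
  obtain ⟨c, hc, hdet⟩ := det_hankel_gaussMoment hN
  have hint : ∀ p, ∫ x : Fin N → ℝ, gueWeight N x * (∏ j, x j) ^ (2 * p) =
      N.factorial * (c * momentProd N p) := fun p => by
    rw [integral_gueWeight_mul_prod_pow hN, hdet, momentProd, Finset.prod_range,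
      Finset.prod_range]
  have hZ : gueZ N = N.factorial * (c * momentProd N 0) := by
    rw [← hint 0, gueZ]
    simp
  have hN0 : (N.factorial : ℝ) ≠ 0 := by positivity
  unfold gueDetMoment gueProb
  simp only [gueMatrix_det, ← Complex.ofReal_pow]
  rw [integral_complex_ofReal,
    integral_fun_snd (fun x : Fin N → ℝ => (∏ j, x j) ^ (2 * p)), probReal_univ, one_smul,
    gueEigenvalueLaw, integral_withDensity_eq_integral_toReal_smul (measurable_gueDensity N)
      (ae_of_all _ fun _ => ENNReal.ofReal_lt_top)]
  simp only [toReal_gueDensity_smul]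
  rw [integral_const_mul, hint, hZ]
  congr 1
  rw [inv_mul_eq_div, mul_div_mul_left _ _ hN0, mul_div_mul_left _ _ hc]

/-! ### The closed form -/

/-- `∏_{i<m} (2 (i + p) + 1)`. -/
def oddProd (m p : ℕ) : ℝ := ∏ i ∈ Finset.range m, (2 * ((i : ℝ) + p) + 1)

/-- Both sides are the product of the odd numbers from 2p + 1 to 2(m + p) + 1. -/
theorem oddProd_succ_right (m p : ℕ) :
    oddProd m (p + 1) * (2 * p + 1) = oddProd m p * (2 * ((m : ℝ) + p) + 1) := by
  induction m with
  | zero => simp [oddProd]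
  | succ m ih =>
    have h : ∀ q, oddProd (m + 1) q = oddProd m q * (2 * ((m : ℝ) + q) + 1) := fun q => by
      rw [oddProd, Finset.prod_range_succ, oddProd]
    rw [h, h, mul_right_comm, ih]
    push_cast
    ring

/-- The factors of (2m + 2p)!/(2p)! separate into odd ones, giving `oddProd m p`, and even ones,
giving 2^m (m + p)!/p!. -/
theorem factorial_two_mul_add (m p : ℕ) :
    ((2 * m + 2 * p).factorial : ℝ) * p.factorial =
      (2 * p).factorial * (oddProd m p * 2 ^ m * (m + p).factorial) := by
  induction m with
  | zero => simp [oddProd]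
  | succ m ih =>
    have h : oddProd (m + 1) p = oddProd m p * (2 * ((m : ℝ) + p) + 1) := by
      rw [oddProd, Finset.prod_range_succ, oddProd]
    rw [show 2 * (m + 1) + 2 * p = 2 * m + 2 * p + 1 + 1 by ring,
      show m + 1 + p = m + p + 1 by ring, Nat.factorial_succ, Nat.factorial_succ,
      Nat.factorial_succ, h, pow_succ]
    push_cast
    linear_combination (2 * (m : ℝ) + 2 * p + 1 + 1) * (2 * m + 2 * p + 1) * ih

theorem momentProd_pos {N : ℕ} (hN : 1 ≤ N) (p : ℕ) : 0 < momentProd N p :=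
  mul_pos (Finset.prod_pos fun _ _ => gaussMoment_two_mul_pos hN _)
    (Finset.prod_pos fun _ _ => gaussMoment_two_mul_pos hN _)

/-- Raising p shifts every moment one step along its recurrence; the two index ranges have total
length N, hence the power of N. -/
theorem momentProd_succ {N : ℕ} (hN : 1 ≤ N) (p : ℕ) :
    momentProd N (p + 1) = momentProd N p *
      (oddProd ((N + 1) / 2) p * oddProd (N / 2) (p + 1) / (N : ℝ) ^ N) := by
  have hN0 : (N : ℝ) ≠ 0 := by positivity
  have h : ∀ n q, ∏ i ∈ Finset.range n, gaussMoment N (2 * (i + q + 1)) =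
      (∏ i ∈ Finset.range n, gaussMoment N (2 * (i + q))) * (oddProd n q / (N : ℝ) ^ n) := by
    intro n q
    induction n with
    | zero => simp [oddProd]
    | succ n ih =>
      have h2 : oddProd (n + 1) q = oddProd n q * (2 * ((n : ℝ) + q) + 1) := by
        rw [oddProd, Finset.prod_range_succ, oddProd]
      rw [Finset.prod_range_succ, Finset.prod_range_succ, ih, gaussMoment_two_mul_succ hN, h2]
      push_cast
      field_simp
      ring
  have h1 := h ((N + 1) / 2) p
  have h2 := h (N / 2) (p + 1)
  have e : ∀ i, i + 1 + (p + 1) = i + (p + 1) + 1 := fun i => by ring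
  have e' : ∀ i, i + 1 + p = i + (p + 1) := fun i => by ring
  have hpow : (N : ℝ) ^ N = (N : ℝ) ^ ((N + 1) / 2) * (N : ℝ) ^ (N / 2) := by
    rw [← pow_add]
    congr 1
    omega
  simp only [momentProd, e, e', hpow]
  rw [h2]
  simp only [← add_assoc] at h1 ⊢
  rw [h1]
  ring

theorem Cpart_rectPart (N k : ℕ) :
    Cpart (rectPart N k) k =
      ∏ i ∈ Finset.range k, ((N + i).factorial : ℝ) / (i.factorial : ℝ) := by
  unfold Cpart
  refine Finset.prod_bij' (fun j _ => k - j) (fun i _ => k - i) ?_ ?_ ?_ ?_ ?_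
  · intro j hj
    simp only [Finset.mem_Icc, Finset.mem_range] at *
    omega
  · intro j hj
    simp only [Finset.mem_Icc, Finset.mem_range] at *
    omega
  · intro j hj
    simp only [Finset.mem_Icc] at *
    omega
  · intro j hj
    simp only [Finset.mem_range] at *
    omega
  · intro j hj
    have hj' := Finset.mem_Icc.mp hj
    rw [rectPart, if_pos hj', Nat.add_sub_assoc hj'.2]

theorem Cpart_rectPart_two_mul_succ (N p : ℕ) :
    Cpart (rectPart N (2 * (p + 1))) (2 * (p + 1)) = Cpart (rectPart N (2 * p)) (2 * p) *
      (((N + 2 * p).factorial : ℝ) * (N + 2 * p + 1).factorial /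
        ((2 * p).factorial * (2 * p + 1).factorial)) := by
  rw [Cpart_rectPart, Cpart_rectPart, show 2 * (p + 1) = 2 * p + 1 + 1 by ring,
    Finset.prod_range_succ, Finset.prod_range_succ, mul_assoc, div_mul_div_comm, add_assoc N]

theorem De_succ (p N : ℕ) :
    De (p + 1) N = De p N * ((p.factorial : ℝ) ^ 2 / ((N / 2 + p).factorial : ℝ) ^ 2) := by
  rw [De, Finset.prod_range_succ, De]

/-- The prefactor contributes -1/(m + p + 1), which turns one of the two factors (m + p)! into (m +
p + 1)!. -/
theorem Do_succ (p N : ℕ) :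
    Do (p + 1) N = Do p N *
      (-((p.factorial : ℝ) ^ 2 / ((N / 2 + p).factorial * (N / 2 + p + 1).factorial))) := by
  have h := Nat.factorial_ne_zero (N / 2 + p)
  rw [Do, Finset.prod_range_succ, Do, ← add_assoc, Nat.factorial_succ (N / 2 + p)]
  push_cast
  field_simp
  ring

theorem momentProd_div_even {N : ℕ} (hN : 1 ≤ N) (he : Even N) (p : ℕ) :
    momentProd N p / momentProd N 0 =
      (-(1 / (2 * (N : ℝ)))) ^ (N * p) * (Cpart (rectPart N (2 * p)) (2 * p) * De p N) := by
  have h0 := (momentProd_pos hN 0).ne'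
  induction p with
  | zero => simp [Cpart, De, h0]
  | succ p ih =>
    rw [momentProd_succ hN, mul_div_right_comm, ih, Cpart_rectPart_two_mul_succ, De_succ, mul_add,
      pow_add, mul_one, he.neg_pow (1 / (2 * (N : ℝ)))]
    have hN0 : (N : ℝ) ≠ 0 := by positivity
    obtain ⟨m, rfl⟩ := he.two_dvd
    have e1 : (2 * m + 1) / 2 = m := by omega
    have e2 : 2 * m / 2 = m := by omega
    have h1 := factorial_two_mul_add m p
    have h2 := oddProd_succ_right m p
    have hp : (2 * (p : ℝ) + 1) ≠ 0 := by positivity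
    have hf1 : ((2 * p).factorial : ℝ) ≠ 0 := by positivity
    have hf2 : (p.factorial : ℝ) ≠ 0 := by positivity
    have hf3 : ((m + p).factorial : ℝ) ≠ 0 := by positivity
    have h1' : ((2 * m + 2 * p).factorial : ℝ) =
      (2 * p).factorial * (oddProd m p * 2 ^ m * (m + p).factorial) / p.factorial := by
      rw [eq_div_iff hf2, h1]
    have h2' : oddProd m (p + 1) = oddProd m p * (2 * ((m : ℝ) + p) + 1) / (2 * p + 1) := by
      rw [eq_div_iff hp, h2]
    -- Equality of the factors gained by the two sides from p to p + 1; odd products and factorials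
    -- are both expressed through `oddProd m p`.
    have key : oddProd m p * oddProd m (p + 1) / ((2 * m : ℕ) : ℝ) ^ (2 * m) =
        (1 / (2 * ((2 * m : ℕ) : ℝ))) ^ (2 * m) *
        ((((2 * m + 2 * p).factorial : ℝ) * (2 * m + 2 * p + 1).factorial /
        ((2 * p).factorial * (2 * p + 1).factorial)) *
        ((p.factorial : ℝ) ^ 2 / ((m + p).factorial : ℝ) ^ 2)) := by
      rw [Nat.factorial_succ (2 * m + 2 * p), Nat.factorial_succ (2 * p)]
      simp only [Nat.cast_mul (2 * p + 1), Nat.cast_mul (2 * m + 2 * p + 1)]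
      rw [h1', h2', one_div, mul_inv, mul_pow, inv_pow, inv_pow]
      push_cast at hN0 ⊢
      field_simp
      ring
    rw [e1, e2, key]
    ring

theorem momentProd_div_odd {N : ℕ} (hN : 1 ≤ N) (ho : Odd N) (p : ℕ) :
    momentProd N p / momentProd N 0 =
      (-(1 / (2 * (N : ℝ)))) ^ (N * p) * (Cpart (rectPart N (2 * p)) (2 * p) * Do p N) := by
  have h0 := (momentProd_pos hN 0).ne'
  induction p with
  | zero =>
    have := Nat.factorial_ne_zero (N / 2)
    simp [Cpart, Do, h0, this]
  | succ p ih =>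
    rw [momentProd_succ hN, mul_div_right_comm, ih, Cpart_rectPart_two_mul_succ, Do_succ, mul_add,
      pow_add, mul_one, ho.neg_pow (1 / (2 * (N : ℝ)))]
    have hN0 : (N : ℝ) ≠ 0 := by positivity
    obtain ⟨m, rfl⟩ := ho
    have e1 : (2 * m + 1 + 1) / 2 = m + 1 := by omega
    have e2 : (2 * m + 1) / 2 = m := by omega
    have h1 := factorial_two_mul_add m p
    have h2 := oddProd_succ_right m p
    have h3 : oddProd (m + 1) p = oddProd m p * (2 * ((m : ℝ) + p) + 1) := by
      rw [oddProd, Finset.prod_range_succ, oddProd]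
    have hp : (2 * (p : ℝ) + 1) ≠ 0 := by positivity
    have hf1 : ((2 * p).factorial : ℝ) ≠ 0 := by positivity
    have hf2 : (p.factorial : ℝ) ≠ 0 := by positivity
    have hf3 : ((m + p).factorial : ℝ) ≠ 0 := by positivity
    have h1' : ((2 * m + 2 * p).factorial : ℝ) =
      (2 * p).factorial * (oddProd m p * 2 ^ m * (m + p).factorial) / p.factorial := by
      rw [eq_div_iff hf2, h1]
    have h2' : oddProd m (p + 1) = oddProd m p * (2 * ((m : ℝ) + p) + 1) / (2 * p + 1) := by
      rw [eq_div_iff hp, h2]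
    -- The minus sign from the odd power of -1/(2N) has cancelled the one in `Do_succ`, so this
    -- identity carries no sign.
    have key : oddProd (m + 1) p * oddProd m (p + 1) / ((2 * m + 1 : ℕ) : ℝ) ^ (2 * m + 1) =
        (1 / (2 * ((2 * m + 1 : ℕ) : ℝ))) ^ (2 * m + 1) *
        ((((2 * m + 1 + 2 * p).factorial : ℝ) * (2 * m + 1 + 2 * p + 1).factorial /
        ((2 * p).factorial * (2 * p + 1).factorial)) *
        ((p.factorial : ℝ) ^ 2 / ((m + p).factorial * (m + p + 1).factorial))) := by
      rw [show 2 * m + 1 + 2 * p = 2 * m + 2 * p + 1 by ring,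
        Nat.factorial_succ (2 * m + 2 * p + 1), Nat.factorial_succ (2 * m + 2 * p),
        Nat.factorial_succ (2 * p), Nat.factorial_succ (m + p)]
      simp only [Nat.cast_mul (_ + 1)]
      have hmp : (m : ℝ) + p + 1 ≠ 0 := by positivity
      rw [h1', h2', h3, one_div, mul_inv, mul_pow, inv_pow, inv_pow]
      push_cast at hN0 ⊢
      field_simp
      ring
    rw [e1, e2, key]
    ring

/-! ### Expansions to first order in `1 / N` -/

/-- `f N = 1 + c / N + O(N⁻²)` along `l`. -/
def IsOneAddDiv (l : Filter ℕ) (f : ℕ → ℝ) (c : ℝ) : Prop :=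
  (fun N => f N - (1 + c / N)) =O[l] fun N : ℕ => 1 / (N : ℝ) ^ 2

theorem tendsto_div_natCast {l : Filter ℕ} (hl : l ≤ atTop) (c : ℝ) :
    Tendsto (fun N : ℕ => c / (N : ℝ)) l (𝓝 0) :=
  (tendsto_const_div_atTop_nhds_zero_nat c).mono_left hl

theorem tendsto_one_div_natCast_sq {l : Filter ℕ} (hl : l ≤ atTop) :
    Tendsto (fun N : ℕ => 1 / (N : ℝ) ^ 2) l (𝓝 0) := by
  have h := (tendsto_div_natCast hl 1).pow 2
  simpa using h

theorem eventually_one_le {l : Filter ℕ} (hl : l ≤ atTop) : ∀ᶠ N : ℕ in l, 1 ≤ N :=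
  hl (eventually_ge_atTop 1)

namespace IsOneAddDiv

variable {l : Filter ℕ} {f g : ℕ → ℝ} {c d : ℝ}

theorem congr' (hf : IsOneAddDiv l f c) (h : f =ᶠ[l] g) : IsOneAddDiv l g c :=
  IsBigO.congr' hf (h.mono fun N hN => by simp only [hN]) EventuallyEq.rfl

theorem mono {l' : Filter ℕ} (hf : IsOneAddDiv l f c) (h : l' ≤ l) : IsOneAddDiv l' f c :=
  IsBigO.mono hf h

theorem one_add_div (l : Filter ℕ) (c : ℝ) : IsOneAddDiv l (fun N => 1 + c / N) c := by
  simp only [IsOneAddDiv, sub_self]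
  exact isBigO_zero _ _

theorem one (l : Filter ℕ) : IsOneAddDiv l (fun _ => 1) 0 := by
  simpa using one_add_div l 0

theorem tendsto_one (hl : l ≤ atTop) (hf : IsOneAddDiv l f c) : Tendsto f l (𝓝 1) := by
  have h1 := (IsBigO.trans_tendsto hf (tendsto_one_div_natCast_sq hl)).add
    ((tendsto_div_natCast hl c).const_add 1)
  simpa using h1

theorem mul (hl : l ≤ atTop) (hf : IsOneAddDiv l f c) (hg : IsOneAddDiv l g d) :
    IsOneAddDiv l (fun N => f N * g N) (c + d) := by
  have hg1 : g =O[l] fun _ => (1 : ℝ) := (hg.tendsto_one hl).isBigO_one ℝ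
  have hc1 : (fun N : ℕ => 1 + c / (N : ℝ)) =O[l] fun _ => (1 : ℝ) :=
    ((one_add_div l c).tendsto_one hl).isBigO_one ℝ
  -- With F = 1 + c/N and G = 1 + d/N, the error is (f - F) g + F (g - G) + cd/N².
  have h1 := IsBigO.mul hf hg1
  have h2 := hc1.mul hg
  have h3 : (fun N : ℕ => c * d * (1 / (N : ℝ) ^ 2)) =O[l] fun N : ℕ => 1 / (N : ℝ) ^ 2 :=
    (isBigO_refl _ l).const_mul_left _
  simp only [one_mul, mul_one] at h1 h2
  refine ((h1.add h2).add h3).congr' (Eventually.of_forall fun N => ?_) EventuallyEq.rfl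
  simp only
  ring

theorem inv (hl : l ≤ atTop) (hf : IsOneAddDiv l f c) :
    IsOneAddDiv l (fun N => (f N)⁻¹) (-c) := by
  have ht := hf.tendsto_one hl
  have hi : (fun N => (f N)⁻¹) =O[l] fun _ => (1 : ℝ) :=
    (ht.inv₀ one_ne_zero).isBigO_one ℝ
  -- The error equals f⁻¹ (1 - f (1 - c/N)), and f (1 - c/N) has first coefficient 0.
  have h := (hf.mul hl (one_add_div l (-c)))
  have h2 := hi.mul (IsBigO.neg_left h)
  simp only [one_mul] at h2
  refine h2.congr' ?_ EventuallyEq.rfl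
  filter_upwards [ht.eventually_ne one_ne_zero] with N hN
  rw [add_neg_cancel, zero_div]
  field_simp
  ring

theorem div (hl : l ≤ atTop) (hf : IsOneAddDiv l f c) (hg : IsOneAddDiv l g d) :
    IsOneAddDiv l (fun N => f N / g N) (c - d) := by
  simpa only [div_eq_mul_inv, sub_eq_add_neg] using hf.mul hl (hg.inv hl)

theorem exp {h : ℕ → ℝ} (hl : l ≤ atTop)
    (hh : (fun N => h N - c / N) =O[l] fun N : ℕ => 1 / (N : ℝ) ^ 2) :
    IsOneAddDiv l (fun N => Real.exp (h N)) c := by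
  have h0 : (fun N : ℕ => 1 / (N : ℝ) ^ 2) =O[l] fun N : ℕ => 1 / (N : ℝ) := by
    have h1 : (fun N : ℕ => 1 / (N : ℝ)) =O[l] fun _ => (1 : ℝ) :=
      (tendsto_div_natCast hl 1).isBigO_one ℝ
    refine (h1.mul (isBigO_refl (fun N : ℕ => 1 / (N : ℝ)) l)).congr ?_ ?_
    · intro N; ring
    · intro N; ring
  have h1 : h =O[l] fun N : ℕ => 1 / (N : ℝ) := by
    have h3 : (fun N : ℕ => c * (1 / (N : ℝ))) =O[l] fun N : ℕ => 1 / (N : ℝ) :=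
      (isBigO_refl _ l).const_mul_left c
    refine ((hh.trans h0).add h3).congr_left fun N => ?_
    ring
  have ht : Tendsto h l (𝓝 0) := h1.trans_tendsto (tendsto_div_natCast hl 1)
  have h2 : (fun N => Real.exp (h N) - 1 - h N) =O[l] fun N : ℕ => 1 / (N : ℝ) ^ 2 := by
    have h3 : (fun N => Real.exp (h N) - 1 - h N) =O[l] fun N => h N ^ 2 := by
      refine IsBigO.of_bound 1 ?_
      have h4 : ∀ᶠ N in l, |h N| < 1 := by
        have := ht.abs
        rw [abs_zero] at this
        exact this.eventually_lt_const one_pos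
      filter_upwards [h4] with N hN
      rw [one_mul, Real.norm_eq_abs, Real.norm_of_nonneg (sq_nonneg _)]
      exact Real.abs_exp_sub_one_sub_id_le hN.le
    refine (h3.trans (h1.pow 2)).congr_right fun N => ?_
    ring
  refine (h2.add hh).congr_left fun N => ?_
  ring

/-- Products of linear factors `1 + (a i + b) / N`. -/
theorem prod_range (hl : l ≤ atTop) (a b : ℝ) (k : ℕ) :
    IsOneAddDiv l (fun N => ∏ i ∈ Finset.range k, (1 + (a * i + b) / N))
      (a * (k * (k - 1) / 2) + b * k) := by
  induction k with
  | zero => simpa using one l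
  | succ k ih =>
    simp only [Finset.prod_range_succ]
    convert ih.mul hl (one_add_div l (a * k + b)) using 1
    push_cast
    ring

end IsOneAddDiv

theorem evenTop_le : evenTop ≤ atTop := inf_le_left

theorem oddTop_le : oddTop ≤ atTop := inf_le_left

theorem eventually_even : ∀ᶠ N in evenTop, Even N :=
  (inf_le_right : evenTop ≤ _) (mem_principal_self _)

theorem eventually_odd : ∀ᶠ N in oddTop, Odd N :=
  (inf_le_right : oddTop ≤ _) (mem_principal_self _)

theorem evenTop_sup_oddTop : evenTop ⊔ oddTop = atTop := by
  rw [evenTop, oddTop, ← inf_sup_left, sup_principal]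
  have h : {N : ℕ | Even N} ∪ {N : ℕ | Odd N} = Set.univ :=
    Set.eq_univ_of_forall fun N => N.even_or_odd
  rw [h, principal_univ, inf_top_eq]

/-- Evenness makes the natural-number quotient N / 2 exact, and c/(N/2) = 2c/N. -/
theorem IsOneAddDiv.comp_half {f : ℕ → ℝ} {c : ℝ} (hf : IsOneAddDiv atTop f c) :
    IsOneAddDiv evenTop (fun N => f (N / 2)) (2 * c) := by
  have ht : Tendsto (fun N : ℕ => N / 2) evenTop atTop :=
    (Nat.tendsto_div_const_atTop two_ne_zero).mono_left evenTop_le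
  have h := IsBigO.comp_tendsto hf ht
  have h4 : (fun N : ℕ => 4 * (1 / (N : ℝ) ^ 2)) =O[evenTop] fun N : ℕ => 1 / (N : ℝ) ^ 2 :=
    (isBigO_refl _ _).const_mul_left _
  have hcast : ∀ N : ℕ, Even N → ((N / 2 : ℕ) : ℝ) = N / 2 := fun N hN => by
    rw [Nat.cast_div hN.two_dvd (by norm_num)]
    norm_num
  refine IsBigO.trans (h.congr' ?_ ?_) h4
  · filter_upwards [eventually_even] with N hN
    simp only [Function.comp, hcast N hN]
    ring
  · filter_upwards [eventually_even] with N hN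
    simp only [Function.comp, hcast N hN]
    ring

/-- Replacing c/(N + 1) by c/N costs only O(N⁻²). This carries estimates from even to odd N. -/
theorem IsOneAddDiv.comp_add_one {f : ℕ → ℝ} {c : ℝ} (hf : IsOneAddDiv evenTop f c) :
    IsOneAddDiv oddTop (fun N => f (N + 1)) c := by
  have ht : Tendsto (fun N : ℕ => N + 1) oddTop evenTop :=
    tendsto_inf.mpr ⟨(tendsto_add_atTop_nat 1).mono_left oddTop_le,
      tendsto_principal.mpr (eventually_odd.mono fun N hN => hN.add_one)⟩
  have h := IsBigO.comp_tendsto hf ht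
  have h1 : (fun N : ℕ => 1 / ((N + 1 : ℕ) : ℝ) ^ 2) =O[oddTop] fun N : ℕ => 1 / (N : ℝ) ^ 2 := by
    refine IsBigO.of_bound 1 ?_
    filter_upwards [eventually_one_le oddTop_le] with N hN
    have hN0 : (0 : ℝ) < N := by positivity
    rw [one_mul, Real.norm_of_nonneg (by positivity), Real.norm_of_nonneg (by positivity)]
    push_cast
    gcongr
    linarith
  have h2 : (fun N : ℕ => c / ((N + 1 : ℕ) : ℝ) - c / N) =O[oddTop]
      fun N : ℕ => 1 / (N : ℝ) ^ 2 := by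
    refine IsBigO.of_bound |c| ?_
    filter_upwards [eventually_one_le oddTop_le] with N hN
    have hN0 : (0 : ℝ) < N := by positivity
    have e : c / ((N + 1 : ℕ) : ℝ) - c / N = -c * (1 / (((N : ℝ) + 1) * N)) := by
      push_cast
      field_simp
      ring
    rw [e, norm_mul, Real.norm_eq_abs, abs_neg, Real.norm_of_nonneg (by positivity),
      Real.norm_of_nonneg (by positivity), sq]
    gcongr
    linarith
  refine ((h.trans h1).add h2).congr_left fun N => ?_
  simp only [Function.comp]
  ring

/-! ### Stirling's formula with its first correction -/

/-- A monotone sandwich: log s_n - 1/(12n) increases and log s_n - 1/(12n) + 1/n² decreases, both to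
log √π. -/
theorem log_stirlingSeq_sub_le {n : ℕ} (hn : 1 ≤ n) :
    |Real.log (Stirling.stirlingSeq n) - Real.log (√Real.pi) - 1 / 12 / n| ≤ 1 / (n : ℝ) ^ 2 := by
  have hlim : Tendsto (fun n : ℕ => Real.log (Stirling.stirlingSeq (n + 1))) atTop
      (𝓝 (Real.log (√Real.pi))) :=
    ((Real.continuousAt_log (by positivity)).tendsto.comp
      (Stirling.tendsto_stirlingSeq_sqrt_pi.comp (tendsto_add_atTop_nat 1)))
  have hdiv : Tendsto (fun n : ℕ => 1 / 12 / ((n + 1 : ℕ) : ℝ)) atTop (𝓝 0) :=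
    (tendsto_const_div_atTop_nhds_zero_nat (1 / 12 : ℝ)).comp (tendsto_add_atTop_nat 1)
  have hdiv2 : Tendsto (fun n : ℕ => 1 / ((n + 1 : ℕ) : ℝ) ^ 2) atTop (𝓝 0) :=
    (tendsto_one_div_natCast_sq le_rfl).comp (tendsto_add_atTop_nat 1)
  obtain ⟨m, rfl⟩ : ∃ m, n = m + 1 := ⟨n - 1, by omega⟩
  have hmono : Monotone fun n : ℕ =>
      Real.log (Stirling.stirlingSeq (n + 1)) - 1 / 12 / ((n + 1 : ℕ) : ℝ) := by
    refine monotone_nat_of_le_succ fun n => ?_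
    have h := Stirling.log_stirlingSeq_sdiff_le (n + 1)
    have e : 1 / (12 * ((n + 1 : ℕ) : ℝ) * ((n + 1 : ℕ) + 1)) =
        1 / 12 / ((n + 1 : ℕ) : ℝ) - 1 / 12 / ((n + 1 + 1 : ℕ) : ℝ) := by
      push_cast
      field_simp
      ring
    rw [e] at h
    linarith
  have hanti : Antitone fun n : ℕ =>
      Real.log (Stirling.stirlingSeq (n + 1)) - 1 / 12 / ((n + 1 : ℕ) : ℝ) +
        1 / ((n + 1 : ℕ) : ℝ) ^ 2 := by
    refine antitone_nat_of_succ_le fun n => ?_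
    -- The first term of the series for the decrement is 1/(3(2x + 1)²) with x = n + 1. It falls
    -- short of 1/(12x(x + 1)) by order x⁻⁴, which the order x⁻³ decrement of 1/x² absorbs.
    have h := (Stirling.log_stirlingSeq_sdiff_hasSum n).summable.le_tsum 0
      (fun k _ => by positivity)
    rw [(Stirling.log_stirlingSeq_sdiff_hasSum n).tsum_eq] at h
    have e : 1 / 12 / ((n + 1 : ℕ) : ℝ) - 1 / 12 / ((n + 1 + 1 : ℕ) : ℝ) -
        (1 / ((n + 1 : ℕ) : ℝ) ^ 2 - 1 / ((n + 1 + 1 : ℕ) : ℝ) ^ 2) ≤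
        1 / (2 * ((0 + 1 : ℕ) : ℝ) + 1) * ((1 / (2 * ((n + 1 : ℕ) : ℝ) + 1)) ^ 2) ^ (0 + 1) := by
      set x : ℝ := ((n + 1 : ℕ) : ℝ) with hx
      have hx1 : 0 < x := by positivity
      have hx2 : ((n + 1 + 1 : ℕ) : ℝ) = x + 1 := by rw [hx]; push_cast; ring
      rw [hx2]
      have e1 : 1 / (2 * ((0 + 1 : ℕ) : ℝ) + 1) * ((1 / (2 * x + 1)) ^ 2) ^ (0 + 1) -
          (1 / 12 / x - 1 / 12 / (x + 1) - (1 / x ^ 2 - 1 / (x + 1) ^ 2)) =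
          (12 * (2 * x + 1) ^ 3 - x * (x + 1)) / (12 * x ^ 2 * (x + 1) ^ 2 * (2 * x + 1) ^ 2) := by
        push_cast
        field_simp
        ring
      have e2 : 0 ≤ (12 * (2 * x + 1) ^ 3 - x * (x + 1)) /
          (12 * x ^ 2 * (x + 1) ^ 2 * (2 * x + 1) ^ 2) := by
        refine div_nonneg ?_ (by positivity)
        ring_nf
        positivity
      linarith
    linarith
  have h1 := hmono.ge_of_tendsto (hlim.sub hdiv) m
  have h2 := hanti.le_of_tendsto ((hlim.sub hdiv).add hdiv2) m
  rw [abs_le]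
  constructor
  · linarith
  · have : (0 : ℝ) ≤ 1 / ((m + 1 : ℕ) : ℝ) ^ 2 := by positivity
    linarith

theorem isOneAddDiv_stirlingSeq :
    IsOneAddDiv atTop (fun n => Stirling.stirlingSeq n / √Real.pi) (1 / 12) := by
  have h : IsOneAddDiv atTop
      (fun n => Real.exp (Real.log (Stirling.stirlingSeq n) - Real.log (√Real.pi))) (1 / 12) := by
    refine IsOneAddDiv.exp le_rfl (IsBigO.of_bound 1 ?_)
    filter_upwards [eventually_ge_atTop 1] with n hn
    rw [one_mul, Real.norm_eq_abs, Real.norm_of_nonneg (by positivity)]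
    exact log_stirlingSeq_sub_le hn
  refine h.congr' ?_
  filter_upwards [eventually_ge_atTop 1] with n hn
  obtain ⟨m, rfl⟩ : ∃ m, n = m + 1 := ⟨n - 1, by omega⟩
  rw [Real.exp_sub, Real.exp_log (Stirling.stirlingSeq'_pos m), Real.exp_log (by positivity)]

/-- Squaring removes the square root from Stirling's formula. -/
theorem factorial_sq_eq_stirlingSeq {n : ℕ} (hn : 1 ≤ n) :
    (n.factorial : ℝ) ^ 2 =
      Stirling.stirlingSeq n ^ 2 * (2 * n * ((n : ℝ) / Real.exp 1) ^ (2 * n)) := by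
  have hn0 : (0 : ℝ) < n := by positivity
  have h : (n.factorial : ℝ) =
      Stirling.stirlingSeq n * (√(2 * (n : ℝ)) * ((n : ℝ) / Real.exp 1) ^ n) := by
    rw [Stirling.stirlingSeq]
    field_simp
  rw [h, mul_pow, mul_pow, Real.sq_sqrt (by positivity), ← pow_mul, mul_comm n 2]

/-- `N!² / (N/2)!² = 2 (2N)^N e^{-N} (1 - 1 / (6 N) + O(N⁻²))` for even `N`. -/
theorem isOneAddDiv_factorial_even :
    IsOneAddDiv evenTop (fun N => (N.factorial : ℝ) ^ 2 / ((N / 2).factorial : ℝ) ^ 2 /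
      (2 * (2 * (N : ℝ)) ^ N * Real.exp (-(N : ℝ)))) (-1 / 6) := by
  have h1 := isOneAddDiv_stirlingSeq.mono evenTop_le
  have h2 := isOneAddDiv_stirlingSeq.comp_half
  -- The coefficient is 2 · 1/12 - 2 · 1/6 = -1/6.
  have h := (h1.mul evenTop_le h1).div evenTop_le (h2.mul evenTop_le h2)
  norm_num only at h ⊢
  refine h.congr' ?_
  filter_upwards [eventually_even, eventually_one_le evenTop_le] with N hN hN1
  obtain ⟨m, rfl⟩ := hN.two_dvd
  obtain ⟨k, rfl⟩ : ∃ k, m = k + 1 := ⟨m - 1, by omega⟩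
  rw [Nat.mul_div_cancel_left _ two_pos, factorial_sq_eq_stirlingSeq hN1,
    factorial_sq_eq_stirlingSeq (Nat.le_add_left 1 k)]
  have hs1 := (Stirling.stirlingSeq'_pos k).ne'
  have he : Real.exp (-((2 * (k + 1) : ℕ) : ℝ)) = (Real.exp 1 ^ (2 * (k + 1)))⁻¹ := by
    rw [Real.exp_neg, ← Real.exp_nat_mul, mul_one]
  rw [he]
  have hpi : √Real.pi ≠ 0 := by positivity
  have hk : (k : ℝ) + 1 ≠ 0 := by positivity
  push_cast
  simp only [div_pow, mul_pow]
  field_simp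
  ring

/-- From N log(1 + 1/N) = 1 - 1/(2N) + O(N⁻²). It compensates for the shift N → N + 1 in the
Stirling normalisation for odd N. -/
theorem isOneAddDiv_one_add_inv_pow :
    IsOneAddDiv atTop (fun N => (1 + 1 / (N : ℝ)) ^ N * Real.exp (-1)) (-1 / 2) := by
  have h : IsOneAddDiv atTop (fun N => Real.exp (N * Real.log (1 + 1 / (N : ℝ)) + -1)) (-1 / 2) := by
    refine IsOneAddDiv.exp le_rfl (IsBigO.of_bound 2 ?_)
    filter_upwards [eventually_ge_atTop 2] with N hN
    have hN2 : (2 : ℝ) ≤ N := by exact_mod_cast hN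
    have hN0 : (0 : ℝ) < N := by linarith
    have habs : |(-(1 / (N : ℝ)))| = 1 / N := by
      rw [abs_neg, abs_of_pos (by positivity)]
    have hle : 1 / (N : ℝ) ≤ 1 / 2 := by gcongr
    have h := Real.abs_log_sub_add_sum_range_le (x := -(1 / (N : ℝ)))
      (by rw [habs]; linarith) 2
    rw [habs] at h
    rw [Real.norm_eq_abs, Real.norm_of_nonneg (by positivity)]
    have e : N * Real.log (1 + 1 / (N : ℝ)) + -1 - -1 / 2 / N =
        N * (∑ i ∈ Finset.range 2, (-(1 / (N : ℝ))) ^ (i + 1) / ((i : ℝ) + 1) +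
          Real.log (1 - -(1 / (N : ℝ)))) := by
      rw [sub_neg_eq_add, Finset.sum_range_succ, Finset.sum_range_one]
      push_cast
      field_simp
      ring
    rw [e, abs_mul, abs_of_pos hN0]
    -- For N ≥ 2 the denominator is at least 1/2, whence the bound 2.
    have h3 : (1 / (N : ℝ)) ^ (2 + 1) / (1 - 1 / N) ≤ (1 / (N : ℝ)) ^ (2 + 1) / (1 / 2) := by
      gcongr
      linarith
    calc _ ≤ N * ((1 / (N : ℝ)) ^ (2 + 1) / (1 / 2)) :=
          mul_le_mul_of_nonneg_left (h.trans h3) hN0.le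
      _ = 2 * (1 / (N : ℝ) ^ 2) := by
          rw [div_pow, one_pow]
          field_simp
  refine h.congr' (Eventually.of_forall fun N => ?_)
  simp only
  rw [Real.exp_add, Real.exp_nat_mul, Real.exp_log (by positivity)]

/-- `N!² / (m! (m+1)!) = 2 (2N)^N e^{-N} (1 - 2 / (3 N) + O(N⁻²))` for odd `N = 2m + 1`. -/
theorem isOneAddDiv_factorial_odd :
    IsOneAddDiv oddTop
      (fun N => (N.factorial : ℝ) ^ 2 / (((N / 2).factorial : ℝ) * (N / 2 + 1).factorial) /
      (2 * (2 * (N : ℝ)) ^ N * Real.exp (-(N : ℝ)))) (-2 / 3) := by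
  -- The even quotient at N + 1 is 2(N + 1) times the odd one at N, and the normalisations differ by
  -- 2(N + 1)(1 + 1/N)^N e⁻¹. The coefficient is therefore -1/6 - 1/2.
  have h := isOneAddDiv_factorial_even.comp_add_one.mul oddTop_le
    (isOneAddDiv_one_add_inv_pow.mono oddTop_le)
  norm_num only at h ⊢
  refine h.congr' ?_
  filter_upwards [eventually_odd] with N hN
  obtain ⟨m, rfl⟩ := hN
  have e1 : (2 * m + 1 + 1) / 2 = m + 1 := by omega
  have e2 : (2 * m + 1) / 2 = m := by omega
  rw [e1, e2]
  set N := 2 * m + 1 with hN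
  have hN0 : (0 : ℝ) < N := by rw [hN]; positivity
  have hm : (N : ℝ) = 2 * m + 1 := by rw [hN]; push_cast; ring
  have hm1 : (m : ℝ) + 1 = (N + 1) / 2 := by rw [hm]; ring
  have he : Real.exp (-((N + 1 : ℕ) : ℝ)) = Real.exp (-(N : ℝ)) * Real.exp (-1) := by
    rw [← Real.exp_add]
    push_cast
    ring_nf
  have hp : (1 + 1 / (N : ℝ)) ^ N = ((N : ℝ) + 1) ^ N / (N : ℝ) ^ N := by
    rw [← div_pow]
    congr 1
    field_simp
  have hf := Nat.factorial_ne_zero N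
  have hfm := Nat.factorial_ne_zero m
  rw [he, hp, Nat.factorial_succ m, Nat.factorial_succ N]
  push_cast
  rw [hm1, mul_pow 2 ((N : ℝ) + 1), mul_pow 2 (N : ℝ), pow_succ ((N : ℝ) + 1) N]
  field_simp
  ring

/-! ### Asymptotics of the closed form -/

/-- Each new factor n + 1 + i equals (x/a)(1 + (a i + b)/x). With x = N, this writes all shifted
factorials in the form treated by `IsOneAddDiv.prod_range`. -/
theorem factorial_add_eq (n k : ℕ) {x a b : ℝ} (hx : x ≠ 0) (ha : a ≠ 0)
    (h : x + b = a * (n + 1)) :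
    ((n + k).factorial : ℝ) =
      n.factorial * (x / a) ^ k * ∏ i ∈ Finset.range k, (1 + (a * i + b) / x) := by
  induction k with
  | zero => simp
  | succ k ih =>
    have e : (1 + (a * k + b) / x) * (x / a) = ((n + k + 1 : ℕ) : ℝ) := by
      push_cast
      field_simp
      linear_combination h
    rw [Finset.prod_range_succ, ← add_assoc, Nat.factorial_succ, Nat.cast_mul, ih, ← e, pow_succ]
    ring

/-- This increment is exactly the N-independent part of the increments of `Cpart` and `De`, or `Do`
up to sign. -/
theorem gammaConst_succ (p : ℕ) : gammaConst (p + 1) = gammaConst p *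
    ((p.factorial : ℝ) ^ 2 / ((2 * p).factorial * (2 * p + 1).factorial)) := by
  have h : ∀ k : ℕ, ∏ j ∈ Finset.range k, ((p + 1 + j).factorial : ℝ) =
      (∏ j ∈ Finset.range k, ((p + j).factorial : ℝ)) *
        ((p + k).factorial / p.factorial) := by
    intro k
    induction k with
    | zero => simp [Nat.factorial_ne_zero]
    | succ k ih =>
      have := Nat.factorial_ne_zero (p + k)
      rw [Finset.prod_range_succ, Finset.prod_range_succ, ih, show p + 1 + k = p + (k + 1) by ring]
      field_simp
  have h0 : ∏ j ∈ Finset.range p, ((p + j).factorial : ℝ) ≠ 0 :=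
    Finset.prod_ne_zero_iff.mpr fun j _ => by positivity
  simp only [gammaConst, Finset.prod_div_distrib]
  rw [h (p + 1), Finset.prod_range_succ, Finset.prod_range_succ,
    show p + (p + 1) = 2 * p + 1 by ring, show p + p = 2 * p by ring]
  field_simp

theorem gammaConst_pos (p : ℕ) : 0 < gammaConst p :=
  Finset.prod_pos fun _ _ => by positivity

theorem factorial_mul_factorial_eq {N : ℕ} (hN : 1 ≤ N) (p : ℕ) :
    ((N + 2 * p).factorial : ℝ) * (N + 2 * p + 1).factorial =
      (N.factorial : ℝ) ^ 2 * (N : ℝ) ^ (4 * p + 1) *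
        ((∏ i ∈ Finset.range (2 * p), (1 + (1 * i + 1) / (N : ℝ))) *
          ∏ i ∈ Finset.range (2 * p + 1), (1 + (1 * i + 1) / (N : ℝ))) := by
  have hN0 : (N : ℝ) ≠ 0 := by positivity
  rw [add_assoc N, factorial_add_eq N (2 * p) hN0 one_ne_zero (one_mul _).symm,
    factorial_add_eq N (2 * p + 1) hN0 one_ne_zero (one_mul _).symm, div_one,
    show 4 * p + 1 = 2 * p + (2 * p + 1) by ring, pow_add _ (2 * p)]
  ring

/-- The N-dependent growth of C D_e from p to p + 1. The coefficient is -1/6 + (2p + 1)² - 2p(p +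
1), from Stirling, the numerator and the denominator. -/
theorem isOneAddDiv_ratio_even (p : ℕ) :
    IsOneAddDiv evenTop (fun N => ((N + 2 * p).factorial : ℝ) * (N + 2 * p + 1).factorial /
      ((N / 2 + p).factorial : ℝ) ^ 2 /
      (Real.exp (-(N : ℝ)) * (2 * (N : ℝ)) ^ (N + 2 * p + 1)))
      ((12 * (p : ℝ) ^ 2 + 12 * p + 5) / 6) := by
  have hl := evenTop_le
  have hq := IsOneAddDiv.prod_range hl 2 2 p
  have h := (isOneAddDiv_factorial_even.mul hl
    ((IsOneAddDiv.prod_range hl 1 1 (2 * p)).mul hl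
      (IsOneAddDiv.prod_range hl 1 1 (2 * p + 1)))).div hl (hq.mul hl hq)
  have hc : (12 * (p : ℝ) ^ 2 + 12 * p + 5) / 6 = -1 / 6 +
      (1 * (((2 * p : ℕ) : ℝ) * ((2 * p : ℕ) - 1) / 2) + 1 * (2 * p : ℕ) +
      (1 * (((2 * p + 1 : ℕ) : ℝ) * ((2 * p + 1 : ℕ) - 1) / 2) + 1 * (2 * p + 1 : ℕ))) -
      (2 * ((p : ℝ) * (p - 1) / 2) + 2 * p + (2 * ((p : ℝ) * (p - 1) / 2) + 2 * p)) := by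
    push_cast
    ring
  rw [hc]
  refine h.congr' ?_
  filter_upwards [eventually_even, eventually_one_le hl] with N hN hN1
  have hN0 : (N : ℝ) ≠ 0 := by positivity
  have hhalf : (N : ℝ) + 2 = 2 * (((N / 2 : ℕ) : ℝ) + 1) := by
    rw [Nat.cast_div hN.two_dvd (by norm_num)]
    push_cast
    ring
  have hQ : ∏ i ∈ Finset.range p, (1 + (2 * (i : ℝ) + 2) / N) ≠ 0 :=
    Finset.prod_ne_zero_iff.mpr fun j _ => by positivity
  have hf := Nat.factorial_ne_zero (N / 2)
  rw [factorial_mul_factorial_eq hN1, factorial_add_eq (N / 2) p hN0 two_ne_zero hhalf]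
  generalize ∏ i ∈ Finset.range p, (1 + (2 * (i : ℝ) + 2) / (N : ℝ)) = Q at *
  generalize ∏ i ∈ Finset.range (2 * p), (1 + (1 * (i : ℝ) + 1) / (N : ℝ)) = A at *
  generalize ∏ i ∈ Finset.range (2 * p + 1), (1 + (1 * (i : ℝ) + 1) / (N : ℝ)) = B at *
  have e1 : (2 * (N : ℝ)) ^ (N + 2 * p + 1) =
      (2 * (N : ℝ)) ^ N * (2 * (2 ^ p) ^ 2 * ((N : ℝ) ^ p) ^ 2 * N) := by ring
  have e2 : (N : ℝ) ^ (4 * p + 1) = ((N : ℝ) ^ p) ^ 4 * N := by ring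
  rw [e1, e2, div_pow]
  field_simp

theorem isOneAddDiv_ratio_odd (p : ℕ) :
    IsOneAddDiv oddTop (fun N => ((N + 2 * p).factorial : ℝ) * (N + 2 * p + 1).factorial /
      (((N / 2 + p).factorial : ℝ) * (N / 2 + p + 1).factorial) /
      (Real.exp (-(N : ℝ)) * (2 * (N : ℝ)) ^ (N + 2 * p + 1)))
      ((6 * (p : ℝ) ^ 2 + 6 * p + 1) / 3) := by
  have hl := oddTop_le
  have h := (isOneAddDiv_factorial_odd.mul hl
    ((IsOneAddDiv.prod_range hl 1 1 (2 * p)).mul hl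
      (IsOneAddDiv.prod_range hl 1 1 (2 * p + 1)))).div hl
      ((IsOneAddDiv.prod_range hl 2 1 p).mul hl (IsOneAddDiv.prod_range hl 2 3 p))
  have hc : (6 * (p : ℝ) ^ 2 + 6 * p + 1) / 3 = -2 / 3 +
      (1 * (((2 * p : ℕ) : ℝ) * ((2 * p : ℕ) - 1) / 2) + 1 * (2 * p : ℕ) +
      (1 * (((2 * p + 1 : ℕ) : ℝ) * ((2 * p + 1 : ℕ) - 1) / 2) + 1 * (2 * p + 1 : ℕ))) -
      (2 * ((p : ℝ) * (p - 1) / 2) + 1 * p + (2 * ((p : ℝ) * (p - 1) / 2) + 3 * p)) := by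
    push_cast
    ring
  rw [hc]
  refine h.congr' ?_
  filter_upwards [eventually_odd, eventually_one_le hl] with N hN hN1
  have hN0 : (N : ℝ) ≠ 0 := by positivity
  have hdiv : (N : ℝ) = 2 * ((N / 2 : ℕ) : ℝ) + 1 := by
    exact_mod_cast (Nat.two_mul_div_two_add_one_of_odd hN).symm
  have h1 : (N : ℝ) + 1 = 2 * (((N / 2 : ℕ) : ℝ) + 1) := by rw [hdiv]; linarith
  have h3 : (N : ℝ) + 3 = 2 * (((N / 2 + 1 : ℕ) : ℝ) + 1) := by push_cast; linarith
  have hQ : ∏ i ∈ Finset.range p, (1 + (2 * (i : ℝ) + 1) / N) ≠ 0 :=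
    Finset.prod_ne_zero_iff.mpr fun j _ => by positivity
  have hR : ∏ i ∈ Finset.range p, (1 + (2 * (i : ℝ) + 3) / N) ≠ 0 :=
    Finset.prod_ne_zero_iff.mpr fun j _ => by positivity
  have hf := Nat.factorial_ne_zero (N / 2)
  have hf' := Nat.factorial_ne_zero (N / 2 + 1)
  rw [factorial_mul_factorial_eq hN1, factorial_add_eq (N / 2) p hN0 two_ne_zero h1,
    add_right_comm (N / 2) p 1, factorial_add_eq (N / 2 + 1) p hN0 two_ne_zero h3]
  generalize ∏ i ∈ Finset.range p, (1 + (2 * (i : ℝ) + 1) / (N : ℝ)) = Q at *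
  generalize ∏ i ∈ Finset.range p, (1 + (2 * (i : ℝ) + 3) / (N : ℝ)) = R at *
  generalize ∏ i ∈ Finset.range (2 * p), (1 + (1 * (i : ℝ) + 1) / (N : ℝ)) = A at *
  generalize ∏ i ∈ Finset.range (2 * p + 1), (1 + (1 * (i : ℝ) + 1) / (N : ℝ)) = B at *
  have e1 : (2 * (N : ℝ)) ^ (N + 2 * p + 1) =
      (2 * (N : ℝ)) ^ N * (2 * (2 ^ p) ^ 2 * ((N : ℝ) ^ p) ^ 2 * N) := by ring
  have e2 : (N : ℝ) ^ (4 * p + 1) = ((N : ℝ) ^ p) ^ 4 * N := by ring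
  rw [e1, e2, div_pow]
  field_simp

theorem exp_mul_pow_succ (N p : ℕ) :
    Real.exp (-((N : ℝ) * (p + 1 : ℕ))) * (2 * (N : ℝ)) ^ (N * (p + 1) + (p + 1) ^ 2) =
      Real.exp (-((N : ℝ) * p)) * (2 * (N : ℝ)) ^ (N * p + p ^ 2) *
        (Real.exp (-(N : ℝ)) * (2 * (N : ℝ)) ^ (N + 2 * p + 1)) := by
  have h1 : Real.exp (-((N : ℝ) * (p + 1 : ℕ))) =
      Real.exp (-((N : ℝ) * p)) * Real.exp (-(N : ℝ)) := by
    rw [← Real.exp_add]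
    push_cast
    ring_nf
  have h2 : N * (p + 1) + (p + 1) ^ 2 = N * p + p ^ 2 + (N + 2 * p + 1) := by ring
  rw [h1, h2, pow_add _ (N * p + p ^ 2)]
  ring

/-- Induction on p: the coefficients of `isOneAddDiv_ratio_even` are the successive differences of
p(4p² + 1)/6. -/
theorem isOneAddDiv_Cpart_mul_De (p : ℕ) :
    IsOneAddDiv evenTop (fun N => Cpart (rectPart N (2 * p)) (2 * p) * De p N /
        (Real.exp (-((N : ℝ) * p)) * (2 * (N : ℝ)) ^ (N * p + p ^ 2) * gammaConst p))
      ((p : ℝ) / 6 * (4 * (p : ℝ) ^ 2 + 1)) := by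
  induction p with
  | zero => simpa [Cpart, De, gammaConst] using IsOneAddDiv.one evenTop
  | succ p ih =>
    have h := ih.mul evenTop_le (isOneAddDiv_ratio_even p)
    have hc : ((p + 1 : ℕ) : ℝ) / 6 * (4 * ((p + 1 : ℕ) : ℝ) ^ 2 + 1) =
        (p : ℝ) / 6 * (4 * (p : ℝ) ^ 2 + 1) + (12 * (p : ℝ) ^ 2 + 12 * p + 5) / 6 := by
      push_cast
      ring
    rw [hc]
    refine h.congr' (Eventually.of_forall fun N => ?_)
    have hp := Nat.factorial_ne_zero p
    have h2p := Nat.factorial_ne_zero (2 * p)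
    have h2p1 := Nat.factorial_ne_zero (2 * p + 1)
    simp only
    rw [exp_mul_pow_succ, Cpart_rectPart_two_mul_succ, De_succ, gammaConst_succ]
    field_simp

theorem isOneAddDiv_Cpart_mul_Do (p : ℕ) :
    IsOneAddDiv oddTop (fun N => Cpart (rectPart N (2 * p)) (2 * p) * Do p N /
        ((-1) ^ p * Real.exp (-((N : ℝ) * p)) * (2 * (N : ℝ)) ^ (N * p + p ^ 2) * gammaConst p))
      ((p : ℝ) / 3 * (2 * (p : ℝ) ^ 2 - 1)) := by
  induction p with
  | zero => simpa [Cpart, Do, gammaConst, Nat.factorial_ne_zero] using IsOneAddDiv.one oddTop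
  | succ p ih =>
    have h := ih.mul oddTop_le (isOneAddDiv_ratio_odd p)
    have hc : ((p + 1 : ℕ) : ℝ) / 3 * (2 * ((p + 1 : ℕ) : ℝ) ^ 2 - 1) =
        (p : ℝ) / 3 * (2 * (p : ℝ) ^ 2 - 1) + (6 * (p : ℝ) ^ 2 + 6 * p + 1) / 3 := by
      push_cast
      ring
    rw [hc]
    refine h.congr' (Eventually.of_forall fun N => ?_)
    have hp := Nat.factorial_ne_zero p
    have h2p := Nat.factorial_ne_zero (2 * p)
    have h2p1 := Nat.factorial_ne_zero (2 * p + 1)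
    simp only
    rw [mul_assoc ((-1 : ℝ) ^ (p + 1)), exp_mul_pow_succ, Cpart_rectPart_two_mul_succ, Do_succ,
      gammaConst_succ, pow_succ (-1 : ℝ)]
    field_simp

/-! ### Asymptotics of the moments -/

theorem leadingTerm_pos {N : ℕ} (hN : 1 ≤ N) (p : ℕ) : 0 < leadingTerm p N := by
  have hN0 : (0 : ℝ) < N := by positivity
  have := gammaConst_pos p
  unfold leadingTerm
  positivity

theorem isOneAddDiv_momentProd_even (p : ℕ) :
    IsOneAddDiv evenTop (fun N => momentProd N p / momentProd N 0 / leadingTerm p N)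
      ((p : ℝ) / 6 * (4 * (p : ℝ) ^ 2 + 1)) := by
  refine (isOneAddDiv_Cpart_mul_De p).congr' ?_
  filter_upwards [eventually_even, eventually_one_le evenTop_le] with N hN hN1
  have hN0 : (N : ℝ) ≠ 0 := by positivity
  rw [momentProd_div_even hN1 hN, (hN.mul_right p).neg_pow, leadingTerm, pow_add, one_div, inv_pow]
  field_simp

theorem isOneAddDiv_momentProd_odd (p : ℕ) :
    IsOneAddDiv oddTop (fun N => momentProd N p / momentProd N 0 / leadingTerm p N)
      ((p : ℝ) / 3 * (2 * (p : ℝ) ^ 2 - 1)) := by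
  refine (isOneAddDiv_Cpart_mul_Do p).congr' ?_
  filter_upwards [eventually_odd, eventually_one_le oddTop_le] with N hN hN1
  have hN0 : (N : ℝ) ≠ 0 := by positivity
  -- For odd N the sign is (-1)^p, which cancels the sign of D_o and leaves a positive moment.
  have h1 : (-(1 / (2 * (N : ℝ)))) ^ (N * p) = ((-1) ^ p)⁻¹ * ((2 * (N : ℝ)) ^ (N * p))⁻¹ := by
    rw [neg_pow, pow_mul, hN.neg_one_pow, one_div, inv_pow, ← inv_pow (-1 : ℝ)]
    norm_num
  rw [momentProd_div_odd hN1 hN, h1, leadingTerm, pow_add]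
  field_simp

theorem brezinHikami_zero (p N : ℕ) : brezinHikami p N 0 = leadingTerm p N := by
  have h4 : √(4 : ℝ) = 2 := by
    rw [show (4 : ℝ) = 2 ^ 2 by norm_num, Real.sqrt_sq two_pos.le]
  have h : 2 * Real.pi * N * rhoSC 0 = 2 * (N : ℝ) := by
    have := Real.pi_ne_zero
    rw [rhoSC, zero_pow two_ne_zero, sub_zero, h4]
    field_simp
  rw [brezinHikami, leadingTerm, h]
  simp

theorem gueDetMoment_div_leadingTerm_isBigO {l : Filter ℕ} (hl : l ≤ atTop) {p : ℕ} {c : ℝ} {g : ℕ → ℝ}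
    (hg : ∀ N : ℕ, g N = 1 + c / N)
    (h : IsOneAddDiv l (fun N => momentProd N p / momentProd N 0 / leadingTerm p N) c) :
    (fun N : ℕ => gueDetMoment N (2 * p) / ((leadingTerm p N : ℝ) : ℂ) - ((g N : ℝ) : ℂ))
      =O[l] fun N : ℕ => 1 / (N : ℝ) ^ 2 := by
  refine IsBigO.of_norm_left (IsBigO.congr' (IsBigO.norm_left h) ?_ EventuallyEq.rfl)
  filter_upwards [eventually_one_le hl] with N hN
  rw [gueDetMoment_eq_momentProd hN, hg, ← Complex.ofReal_div, ← Complex.ofReal_sub,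
    Complex.norm_real]

theorem gueDetMoment_isEquivalent (p : ℕ) :
    (fun N : ℕ => gueDetMoment N (2 * p)) ~[atTop] fun N : ℕ => ((leadingTerm p N : ℝ) : ℂ) := by
  have h : Tendsto (fun N => momentProd N p / momentProd N 0 / leadingTerm p N) atTop (𝓝 1) := by
    -- The parities differ only in the 1/N term, so the two limits agree and glue.
    rw [← evenTop_sup_oddTop]
    exact ((isOneAddDiv_momentProd_even p).tendsto_one evenTop_le).sup
      ((isOneAddDiv_momentProd_odd p).tendsto_one oddTop_le)
  have hne : ∀ᶠ N : ℕ in atTop, ((leadingTerm p N : ℝ) : ℂ) ≠ 0 := by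
    filter_upwards [eventually_ge_atTop 1] with N hN
    exact Complex.ofReal_ne_zero.mpr (leadingTerm_pos hN p).ne'
  rw [isEquivalent_iff_tendsto_one hne]
  have h2 := (Complex.continuous_ofReal.tendsto 1).comp h
  rw [Complex.ofReal_one] at h2
  refine h2.congr' ?_
  filter_upwards [eventually_ge_atTop 1] with N hN
  simp only [Function.comp, Pi.div_apply]
  rw [gueDetMoment_eq_momentProd hN, Complex.ofReal_div]

end

theorem mainTheorem2 (p : ℕ) :
    -- the exact formula for every finite `N`
    (∀ N : ℕ, 1 ≤ N →
      Integrable (fun ω => (gueMatrix N ω).det ^ (2 * p)) (gueProb N) ∧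
      (Even N → gueDetMoment N (2 * p) =
        (((-(1 / (2 * (N : ℝ)))) ^ (N * p) * (Cpart (rectPart N (2 * p)) (2 * p) * De p N) : ℝ) : ℂ)) ∧
      (Odd N → gueDetMoment N (2 * p) =
        (((-(1 / (2 * (N : ℝ)))) ^ (N * p) * (Cpart (rectPart N (2 * p)) (2 * p) * Do p N) : ℝ) : ℂ))) ∧
    -- the expansions of `C D_e` and `C D_o`
    ((fun N : ℕ => Cpart (rectPart N (2 * p)) (2 * p) * De p N /
          (Real.exp (-((N : ℝ) * p)) * (2 * (N : ℝ)) ^ (N * p + p ^ 2) * gammaConst p)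
        - (1 + (p : ℝ) / (6 * N) * (4 * (p : ℝ) ^ 2 + 1)))
      =O[evenTop] fun N : ℕ => 1 / (N : ℝ) ^ 2) ∧
    ((fun N : ℕ => Cpart (rectPart N (2 * p)) (2 * p) * Do p N /
          ((-1) ^ p * Real.exp (-((N : ℝ) * p)) * (2 * (N : ℝ)) ^ (N * p + p ^ 2) * gammaConst p)
        - (1 + (p : ℝ) / (3 * N) * (2 * (p : ℝ) ^ 2 - 1)))
      =O[oddTop] fun N : ℕ => 1 / (N : ℝ) ^ 2) ∧
    -- the leading order of the moments, which is the Brézin–Hikami expression at `t = 0`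
    ((fun N : ℕ => gueDetMoment N (2 * p)) ~[atTop] fun N : ℕ => ((leadingTerm p N : ℝ) : ℂ)) ∧
    (∀ N : ℕ, brezinHikami p N 0 = leadingTerm p N) ∧
    -- the `1 / N` corrections to the moments
    ((fun N : ℕ => gueDetMoment N (2 * p) / ((leadingTerm p N : ℝ) : ℂ)
        - ((1 + (p : ℝ) / (6 * N) * (4 * (p : ℝ) ^ 2 + 1) : ℝ) : ℂ))
      =O[evenTop] fun N : ℕ => 1 / (N : ℝ) ^ 2) ∧
    ((fun N : ℕ => gueDetMoment N (2 * p) / ((leadingTerm p N : ℝ) : ℂ)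
        - ((1 + (p : ℝ) / (3 * N) * (2 * (p : ℝ) ^ 2 - 1) : ℝ) : ℂ))
      =O[oddTop] fun N : ℕ => 1 / (N : ℝ) ^ 2) := by
  have hE : ∀ N : ℕ, 1 + (p : ℝ) / (6 * N) * (4 * (p : ℝ) ^ 2 + 1) =
      1 + (p : ℝ) / 6 * (4 * (p : ℝ) ^ 2 + 1) / N := fun N => by
    rw [← div_div]
    ring
  have hO : ∀ N : ℕ, 1 + (p : ℝ) / (3 * N) * (2 * (p : ℝ) ^ 2 - 1) =
      1 + (p : ℝ) / 3 * (2 * (p : ℝ) ^ 2 - 1) / N := fun N => by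
    rw [← div_div]
    ring
  refine ⟨fun N hN => ⟨integrable_gueMatrix_det_pow hN p, fun he => ?_, fun ho => ?_⟩, ?_, ?_,
    gueDetMoment_isEquivalent p, brezinHikami_zero p,
    gueDetMoment_div_leadingTerm_isBigO evenTop_le hE (isOneAddDiv_momentProd_even p),
    gueDetMoment_div_leadingTerm_isBigO oddTop_le hO (isOneAddDiv_momentProd_odd p)⟩
  · rw [gueDetMoment_eq_momentProd hN, momentProd_div_even hN he]
  · rw [gueDetMoment_eq_momentProd hN, momentProd_div_odd hN ho]
  · simp only [hE]
    exact isOneAddDiv_Cpart_mul_De p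
  · simp only [hO]
    exact isOneAddDiv_Cpart_mul_Do p
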